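/- Let $\|\cdot\|_p$ denote the norm of $L_p[-1,1]$. For $r\ge 1$ let $L_2^r$ be the space of functions $f:[-1,1]\to\mathbb R$ such that $f^{(r-1)}$ exists and is absolutely continuous on $[-1,1]$ and $f^{(r)}\in L_2[-1,1]$, and let $W_2^r=\{f\in L_2^r:\|f^{(r)}\|_2\le 1\}$. Let $r\ge 3$ be an integer and let $k=r-2$ or $k=r-1$. The boundary value problem $$u^{(2r)}=0\ \text{ a.e. on }(-1,1),\qquad u^{(s)}(-1)=(-1)^{k-1}\delta_{r-k-1,s},\quad u^{(s)}(1)=0,\qquad s=0,1,\dots,r-1,$$ has a unique solution $u_0\in L_2^{2r}$, and $u_0$ is a polynomial of degree at most $2r-1$. For every $f\in L_2^r$, $$\|f^{(k)}\|_\infty\le \|u_0^{(r)}\|_2\,\|f\|_2+\|u_0\|_2\,\|f^{(r)}\|_2 .$$ This inequality is sharp: with $A=\|u_0^{(r)}\|_2$, $$\|u_0\|_2=\sup_{f\in W_2^r}\bigl(\|f^{(k)}\|_\infty-A\|f\|_2\bigr),$$ so that $\|u_0\|_2$ is the smallest constant possible in front of $\|f^{(r)}\|_2$ for this $A$. Moreover,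 $A=\|u_0^{(r)}\|_2$ is the smallest $A\ge 0$ for which there is a $B\ge 0$ with $\|f^{(k)}\|_\infty\le A\|f\|_2+B\|f^{(r)}\|_2$ for all $f\in L_2^r$, and it is the sharp constant in the Markov–Nikolskii inequality: the smallest $M$ with $\|Q^{(k)}\|_\infty\le M\|Q\|_2$ for all real polynomials $Q$ of degree at most $r-1$. -/

import Mathlib

open MeasureTheory Set
open scoped ENNReal Polynomial

namespace TaikovInterval

/-- The interval `[-1, 1]`. -/
abbrev I : Set ℝ := Icc (-1) 1

/-- The norm of `L_p[-1, 1]`: `(∫_{-1}^1 |f|^p)^{1/p}` for `1 ≤ p < ∞` and the essential supremum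
of `|f|` over `[-1, 1]` for `p = ∞`. -/
noncomputable def normI (p : ℝ≥0∞) (f : ℝ → ℝ) : ℝ := lpNorm f p (volume.restrict I)

/-- The derivative `f^{(k)}` on `[-1, 1]`, one-sided at the endpoints. -/
noncomputable def D (k : ℕ) (f : ℝ → ℝ) : ℝ → ℝ := iteratedDerivWithin k f I

/-- The space `L_2^r`, `r ≥ 1`: functions on `[-1, 1]` whose derivative `f^{(r-1)}` exists and is
absolutely continuous on `[-1, 1]`, and whose derivative `f^{(r)}`, which then exists almost
everywhere, is in `L_2[-1, 1]`. The values of `f` outside `[-1, 1]` play no role. -/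
structure MemL2 (r : ℕ) (f : ℝ → ℝ) : Prop where
  contDiffOn : ContDiffOn ℝ (r - 1 : ℕ) f I
  absolutelyContinuous : AbsolutelyContinuousOnInterval (D (r - 1) f) (-1) 1
  memLp : MemLp (D r f) 2 (volume.restrict I)

/-- The norms of `f, f', …, f^{(r-1)}` are finite for `f ∈ L_2^r`, so that `normI` is the genuine
norm of these functions. -/
theorem MemL2.memLp_D {r : ℕ} {f : ℝ → ℝ} (hf : MemL2 r f) {k : ℕ} (hk : k + 1 ≤ r) (p : ℝ≥0∞) :
    MemLp (D k f) p (volume.restrict I) := by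
  have hc : ContinuousOn (D k f) I :=
    hf.contDiffOn.continuousOn_iteratedDerivWithin (by exact_mod_cast (by omega : k ≤ r - 1))
      (uniqueDiffOn_Icc (by norm_num))
  obtain ⟨C, hC⟩ := isCompact_Icc.exists_bound_of_continuousOn hc
  exact MemLp.of_bound (hc.aestronglyMeasurable measurableSet_Icc) C
    ((ae_restrict_iff' measurableSet_Icc).2 (Filter.Eventually.of_forall hC))

/-- The class `W_2^r` of the `f ∈ L_2^r` with `‖f^{(r)}‖₂ ≤ 1`. -/
def W (r : ℕ) : Set (ℝ → ℝ) := {f | MemL2 r f ∧ normI 2 (D r f) ≤ 1}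

/-- The inequality `‖f^{(k)}‖_∞ ≤ A ‖f‖₂ + B ‖f^{(r)}‖₂` holds for every `f ∈ L_2^r`. -/
def AdditiveInequality (r k : ℕ) (A B : ℝ) : Prop :=
  ∀ f : ℝ → ℝ, MemL2 r f → normI ∞ (D k f) ≤ A * normI 2 f + B * normI 2 (D r f)

/-- The inequality `‖Q^{(k)}‖_∞ ≤ M ‖Q‖₂` holds for all real polynomials `Q` of degree at most
`n`. -/
def MarkovNikolskii (n k : ℕ) (M : ℝ) : Prop :=
  ∀ Q : ℝ[X], Q.natDegree ≤ n → normI ∞ (D k fun x => Q.eval x) ≤ M * normI 2 fun x => Q.eval x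

/-- `u ∈ L_2^{2r}` solves the boundary value problem `u^{(2r)} = 0` on `(-1, 1)`,
`u^{(s)}(-1) = (-1)^{k-1} δ_{r-k-1,s}` and `u^{(s)}(1) = 0` for `s = 0, …, r-1`.
The sign `(-1)^{k-1}` is written `(-1)^{k+1}` to avoid subtraction of natural numbers. -/
structure IsSolution (r k : ℕ) (u : ℝ → ℝ) : Prop where
  memL2 : MemL2 (2 * r) u
  equation : ∀ᵐ x ∂volume.restrict (Ioo (-1 : ℝ) 1), D (2 * r) u x = 0
  left : ∀ s < r, D s u (-1) = if s + k + 1 = r then (-1) ^ (k + 1) else 0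
  right : ∀ s < r, D s u 1 = 0

end TaikovInterval

namespace TaikovInterval

/-! The proof represents `f^{(k)}(t)` by an integral formula at every point and shows that the worst
point is the endpoint `-1`. For each `t` there are kernels `g_t` and `K_t` with `f^{(k)}(t) = ∫ f
g_t + ∫ f^{(r)} K_t`, and at `t = -1` they are `u^{(r)}` and `ε u` with `ε = ±1`, where `u` is the
polynomial solving the boundary value problem. If `‖g_t‖₂ ≤ ‖u^{(r)}‖₂` and `‖K_t‖₂ ≤ ‖u‖₂` for all
`t` (`HasKernels`), Cauchy–Schwarz gives the inequality.

All sharpness claims come from the endpoint formula (`IsEndpointKernel`). Testing it on `u^{(r)}`,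
of degree at most `r - 1`, gives `A ≥ ‖u^{(r)}‖₂`, both in the additive inequality and in the
Markov–Nikolskii one. Testing it on polynomials with `r`-th derivative `ε u / ‖u‖₂`, shifted by
large multiples of `u^{(r)}`, shows that `‖u‖₂` cannot be lowered.

The kernels are built from the odd primitive `S` of a normalized bell `c (1 - x²)^n`: the zeros of
the bell at `±1` let `∫ f^{(n)} S'` be integrated by parts `n` times without boundary terms. For `k
= r - 1`, `g_t` does not depend on `t` and `K_t = S ± 1/2` on the two sides of `t`. For `k = r - 2`,
with a second bell primitive `T` and an even primitive `a` of `T`, `K_t(x) = |x - t|/2 + t S(x) -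
a(x)` and `g_t = α + t β` with `α ⟂ β`, so `‖g_t‖₂` is largest at `t = ±1`. The norms of the `K_t`
are compared by adding the squares at `x` and `-x`, which reduces to the elementary inequality
`sq_add_sq_le`. -/

/-! ### Norms on `[-1, 1]` -/

theorem setIntegral_I (f : ℝ → ℝ) : ∫ x in I, f x = ∫ x in (-1 : ℝ)..1, f x := by
  rw [intervalIntegral.integral_of_le (by norm_num), integral_Icc_eq_integral_Ioc]

theorem intervalIntegrable_of_integrable {f : ℝ → ℝ}
    (hf : Integrable f (volume.restrict I)) : IntervalIntegrable f volume (-1) 1 :=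
  (intervalIntegrable_iff_integrableOn_Icc_of_le (by norm_num)).2 hf

theorem memLp_of_continuousOn {f : ℝ → ℝ} (hf : ContinuousOn f I) (p : ℝ≥0∞) :
    MemLp f p (volume.restrict I) := by
  obtain ⟨C, hC⟩ := isCompact_Icc.exists_bound_of_continuousOn hf
  exact MemLp.of_bound (hf.aestronglyMeasurable measurableSet_Icc) C
    ((ae_restrict_iff' measurableSet_Icc).2 (Filter.Eventually.of_forall hC))

theorem memLp_eval (P : ℝ[X]) (p : ℝ≥0∞) : MemLp (fun x => P.eval x) p (volume.restrict I) :=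
  memLp_of_continuousOn P.continuous.continuousOn p

theorem normI_nonneg (p : ℝ≥0∞) (f : ℝ → ℝ) : 0 ≤ normI p f := lpNorm_nonneg

theorem normI_congr {p : ℝ≥0∞} {f g : ℝ → ℝ} (h : f =ᵐ[volume.restrict I] g) :
    normI p f = normI p g := by
  unfold normI lpNorm
  rw [eLpNorm_congr_ae h, aestronglyMeasurable_congr h]

theorem normI_two_sq {f : ℝ → ℝ} (hf : MemLp f 2 (volume.restrict I)) :
    normI 2 f ^ 2 = ∫ x in (-1 : ℝ)..1, f x ^ 2 := by
  rw [← setIntegral_I, normI,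
    lpNorm_eq_integral_norm_rpow_toReal (by norm_num) (by norm_num) hf.aestronglyMeasurable]
  have h0 : 0 ≤ ∫ x in I, ‖f x‖ ^ (2 : ℝ≥0∞).toReal := by positivity
  rw [← Real.rpow_natCast, ← Real.rpow_mul h0]
  simp

theorem intervalIntegrable_mul {f g : ℝ → ℝ} (hf : MemLp f 2 (volume.restrict I))
    (hg : MemLp g 2 (volume.restrict I)) :
    IntervalIntegrable (fun x => f x * g x) volume (-1) 1 :=
  intervalIntegrable_of_integrable (hf.integrable_mul hg)

theorem intervalIntegrable_sq {f : ℝ → ℝ} (hf : MemLp f 2 (volume.restrict I)) :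
    IntervalIntegrable (fun x => f x ^ 2) volume (-1) 1 := by
  simpa only [sq] using intervalIntegrable_mul hf hf

/-- The Pythagorean expansion of the square of the norm of a linear combination. -/
theorem normI_two_sq_add_mul {f g : ℝ → ℝ} (hf : MemLp f 2 (volume.restrict I))
    (hg : MemLp g 2 (volume.restrict I)) (s : ℝ) :
    normI 2 (fun x => f x + s * g x) ^ 2 =
      normI 2 f ^ 2 + 2 * s * (∫ x in (-1 : ℝ)..1, f x * g x) + s ^ 2 * normI 2 g ^ 2 := by
  have h : MemLp (fun x => f x + s * g x) 2 (volume.restrict I) := hf.add (hg.const_mul s)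
  rw [normI_two_sq h, normI_two_sq hf, normI_two_sq hg, ← intervalIntegral.integral_const_mul,
    ← intervalIntegral.integral_const_mul, ← intervalIntegral.integral_add,
    ← intervalIntegral.integral_add]
  · congr 1; ext x; ring
  · exact (intervalIntegrable_sq hf).add ((intervalIntegrable_mul hf hg).const_mul _)
  · exact (intervalIntegrable_sq hg).const_mul _
  · exact intervalIntegrable_sq hf
  · exact (intervalIntegrable_mul hf hg).const_mul _

theorem abs_integral_mul_le {f g : ℝ → ℝ} (hf : MemLp f 2 (volume.restrict I))
    (hg : MemLp g 2 (volume.restrict I)) :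
    |∫ x in (-1 : ℝ)..1, f x * g x| ≤ normI 2 f * normI 2 g := by
  have h := discrim_le_zero (a := normI 2 g ^ 2) (b := 2 * ∫ x in (-1 : ℝ)..1, f x * g x)
    (c := normI 2 f ^ 2) fun s => by
      have := normI_two_sq_add_mul hf hg s
      nlinarith [sq_nonneg (normI 2 (fun x => f x + s * g x))]
  refine abs_le_of_sq_le_sq ?_ (mul_nonneg (normI_nonneg _ _) (normI_nonneg _ _))
  unfold discrim at h
  nlinarith

theorem normI_two_const_mul (c : ℝ) {f : ℝ → ℝ} (hf : MemLp f 2 (volume.restrict I)) :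
    normI 2 (fun x => c * f x) = |c| * normI 2 f := by
  have h : MemLp (fun x => c * f x) 2 (volume.restrict I) := hf.const_mul c
  have h2 : normI 2 (fun x => c * f x) ^ 2 = (|c| * normI 2 f) ^ 2 := by
    rw [mul_pow, sq_abs, normI_two_sq h, normI_two_sq hf, ← intervalIntegral.integral_const_mul]
    congr 1; ext x; ring
  exact (pow_left_inj₀ (normI_nonneg _ _) (mul_nonneg (abs_nonneg c) (normI_nonneg _ _))
    two_ne_zero).1 h2

/-- The `L_2` norms of two functions are compared by symmetrization. -/
theorem normI_two_le_of_symm {f g : ℝ → ℝ} (hf : MemLp f 2 (volume.restrict I))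
    (hg : MemLp g 2 (volume.restrict I))
    (h : ∀ x ∈ Icc (0 : ℝ) 1, f x ^ 2 + f (-x) ^ 2 ≤ g x ^ 2 + g (-x) ^ 2) :
    normI 2 f ≤ normI 2 g := by
  have key : ∀ F : ℝ → ℝ, IntervalIntegrable F volume (-1) 1 →
      IntervalIntegrable (fun x => F x + F (-x)) volume 0 1 ∧
      ∫ x in (-1 : ℝ)..1, F x = ∫ x in (0 : ℝ)..1, (F x + F (-x)) := by
    intro F hF
    have h1 : IntervalIntegrable F volume (-1) 0 := hF.mono_set (by
      rw [uIcc_of_le (by norm_num), uIcc_of_le (by norm_num)]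
      exact Icc_subset_Icc_right (by norm_num))
    have h2 : IntervalIntegrable F volume 0 1 := hF.mono_set (by
      rw [uIcc_of_le (by norm_num), uIcc_of_le (by norm_num)]
      exact Icc_subset_Icc_left (by norm_num))
    have h3 : IntervalIntegrable (fun x => F (-x)) volume 0 1 := by
      simpa using ((IntervalIntegrable.iff_comp_neg (by simp)).1 h1).symm
    refine ⟨h2.add h3, ?_⟩
    rw [intervalIntegral.integral_add h2 h3, intervalIntegral.integral_comp_neg,
      ← intervalIntegral.integral_add_adjacent_intervals h1 h2]
    simp [add_comm]
  refine (pow_le_pow_iff_left₀ (normI_nonneg _ _) (normI_nonneg _ _) two_ne_zero).1 ?_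
  rw [normI_two_sq hf, normI_two_sq hg]
  obtain ⟨f1, f2⟩ := key _ (intervalIntegrable_sq hf)
  obtain ⟨g1, g2⟩ := key _ (intervalIntegrable_sq hg)
  rw [f2, g2]
  exact intervalIntegral.integral_mono_on (by norm_num) f1 g1 h

theorem normI_top_le {f : ℝ → ℝ} {C : ℝ} (hC : 0 ≤ C) (h : ∀ x ∈ I, |f x| ≤ C) :
    normI ∞ f ≤ C := by
  by_cases hf : AEStronglyMeasurable f (volume.restrict I)
  · rw [normI, ← toReal_eLpNorm hf, eLpNorm_exponent_top]
    refine ENNReal.toReal_le_of_le_ofReal hC (eLpNormEssSup_le_of_ae_bound ?_)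
    exact (ae_restrict_iff' measurableSet_Icc).2 (Filter.Eventually.of_forall h)
  -- `lpNorm` has the default value `0` when the function is not measurable.
  · rw [normI, lpNorm_of_not_aestronglyMeasurable hf]; exact hC

theorem abs_le_normI_top {f : ℝ → ℝ} (hf : ContinuousOn f I) {x : ℝ} (hx : x ∈ I) :
    |f x| ≤ normI ∞ f := by
  have h := ae_le_lpNorm_exponent_top (memLp_of_continuousOn hf ∞)
  -- The a.e. bound is rewritten as an a.e. equality of continuous functions, which then holds
  -- everywhere.
  have h2 : (fun x => max |f x| (normI ∞ f)) =ᵐ[volume.restrict I] fun _ => normI ∞ f := by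
    filter_upwards [h] with y hy using max_eq_right hy
  have h3 := Measure.eqOn_Icc_of_ae_eq volume (by norm_num) h2
    (hf.abs.sup continuousOn_const) continuousOn_const hx
  exact max_eq_right_iff.1 h3

/-! ### Derivatives on `[-1, 1]` and integration by parts -/

theorem D_succ (k : ℕ) (f : ℝ → ℝ) : D (k + 1) f = derivWithin (D k f) I :=
  iteratedDerivWithin_succ

theorem D_zero (f : ℝ → ℝ) : D 0 f = f := iteratedDerivWithin_zero

theorem uniqueDiffOn_I : UniqueDiffOn ℝ I := uniqueDiffOn_Icc (by norm_num)

theorem D_eval (k : ℕ) (P : ℝ[X]) ⦃x : ℝ⦄ (hx : x ∈ I) :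
    D k (fun x => P.eval x) x = (Polynomial.derivative^[k] P).eval x := by
  induction k generalizing x with
  | zero => simp [D_zero]
  | succ k ih =>
    rw [D_succ, derivWithin_congr ih (ih hx), Function.iterate_succ_apply']
    exact ((Polynomial.derivative^[k] P).hasDerivAt x).hasDerivWithinAt.derivWithin
      (uniqueDiffOn_I x hx)

theorem D_eval_ae (k : ℕ) (P : ℝ[X]) : (D k fun x => P.eval x) =ᵐ[volume.restrict I]
    fun x => (Polynomial.derivative^[k] P).eval x :=
  (ae_restrict_iff' measurableSet_Icc).2 (Filter.Eventually.of_forall (D_eval k P))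

theorem contDiff_eval (P : ℝ[X]) (n : WithTop ℕ∞) : ContDiff ℝ n fun x => P.eval x := by
  simpa [Polynomial.aeval_def] using P.contDiff_aeval (𝕜 := ℝ) n

theorem absolutelyContinuousOnInterval_eval (P : ℝ[X]) (a b : ℝ) :
    AbsolutelyContinuousOnInterval (fun x => P.eval x) a b :=
  (contDiff_eval P 1).contDiffOn.absolutelyContinuousOnInterval

theorem absolutelyContinuousOnInterval_congr {f g : ℝ → ℝ} (h : EqOn f g I)
    (hg : AbsolutelyContinuousOnInterval g (-1) 1) :
    AbsolutelyContinuousOnInterval f (-1) 1 := by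
  rw [absolutelyContinuousOnInterval_iff] at hg ⊢
  intro ε hε
  obtain ⟨δ, hδ, H⟩ := hg ε hε
  refine ⟨δ, hδ, fun E hE hlt => ?_⟩
  convert! H E hE hlt using 1
  refine Finset.sum_congr rfl fun i hi => ?_
  have := hE.1 i hi
  rw [uIcc_of_le (by norm_num)] at this
  rw [h this.1, h this.2]

theorem memL2_eval (r : ℕ) (P : ℝ[X]) : MemL2 r fun x => P.eval x where
  contDiffOn := (contDiff_eval P _).contDiffOn
  absolutelyContinuous := absolutelyContinuousOnInterval_congr (D_eval _ P)
    (absolutelyContinuousOnInterval_eval _ _ _)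
  memLp := (memLp_congr_ae (D_eval_ae r P)).2 (memLp_eval _ _)

theorem MemL2.continuousOn_D {r : ℕ} {f : ℝ → ℝ} (hf : MemL2 r f) {k : ℕ} (hk : k < r) :
    ContinuousOn (D k f) I :=
  hf.contDiffOn.continuousOn_iteratedDerivWithin (by exact_mod_cast (by omega : k ≤ r - 1))
    uniqueDiffOn_I

theorem MemL2.absolutelyContinuous_D {r : ℕ} {f : ℝ → ℝ} (hf : MemL2 r f) {k : ℕ} (hk : k < r) :
    AbsolutelyContinuousOnInterval (D k f) (-1) 1 := by
  rcases (by omega : k = r - 1 ∨ k + 1 ≤ r - 1) with rfl | h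
  · exact hf.absolutelyContinuous
  · refine ContDiffOn.absolutelyContinuousOnInterval ?_
    rw [uIcc_of_le (by norm_num)]
    refine (contDiffOn_one_iff_derivWithin uniqueDiffOn_I).2 ⟨?_, ?_⟩
    · exact hf.contDiffOn.differentiableOn_iteratedDerivWithin
        (by exact_mod_cast (by omega : k < r - 1)) uniqueDiffOn_I
    · rw [← D_succ]
      exact hf.continuousOn_D (by omega)

theorem integral_derivWithin_mul_eval {G : ℝ → ℝ} (hG : AbsolutelyContinuousOnInterval G (-1) 1)
    (P : ℝ[X]) {a b : ℝ} (ha : a ∈ I) (hb : b ∈ I) (hab : a ≤ b) :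
    ∫ x in a..b, derivWithin G I x * P.eval x =
      G b * P.eval b - G a * P.eval a - ∫ x in a..b, G x * P.derivative.eval x := by
  have hsub : uIcc a b ⊆ uIcc (-1 : ℝ) 1 := by
    rw [uIcc_of_le hab, uIcc_of_le (by norm_num)]
    exact Icc_subset_Icc ha.1 hb.2
  have h := (hG.mono hsub).integral_mul_deriv_eq_deriv_mul
    (absolutelyContinuousOnInterval_eval P a b)
  simp only [Polynomial.deriv] at h
  have h2 : ∫ x in a..b, derivWithin G I x * P.eval x = ∫ x in a..b, deriv G x * P.eval x := by
    refine intervalIntegral.integral_congr_ae ?_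
    -- `derivWithin` and `deriv` can differ only at `±1`; `-1` is outside the half-open interval of
    -- integration and `1` is a null set.
    have hne : ∀ᵐ x : ℝ, x ≠ 1 := by simp [ae_iff]
    filter_upwards [hne] with x hx hx2
    rw [uIoc_of_le hab] at hx2
    rw [derivWithin_of_mem_nhds]
    exact Icc_mem_nhds (lt_of_le_of_lt ha.1 hx2.1) (lt_of_le_of_ne (hx2.2.trans hb.2) hx)
  rw [h2, h]; ring

theorem MemL2.integral_D_mul_eval {r : ℕ} {f : ℝ → ℝ} (hf : MemL2 r f) {n : ℕ} (hn : n ≤ r)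
    (P : ℝ[X]) (h1 : ∀ j < n, (Polynomial.derivative^[j] P).eval 1 = 0)
    (h2 : ∀ j < n, (Polynomial.derivative^[j] P).eval (-1) = 0) :
    ∫ x in (-1 : ℝ)..1, D n f x * P.eval x =
      (-1) ^ n * ∫ x in (-1 : ℝ)..1, f x * (Polynomial.derivative^[n] P).eval x := by
  induction n generalizing P with
  | zero => simp [D_zero]
  | succ n ih =>
    rw [D_succ, integral_derivWithin_mul_eval (hf.absolutelyContinuous_D (by omega)) P
      (by simp) (by simp) (by norm_num), ih (by omega)]
    · have e1 := h1 0 (by omega)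
      have e2 := h2 0 (by omega)
      simp only [Function.iterate_zero, id] at e1 e2
      rw [e1, e2, ← Function.iterate_succ_apply]; ring
    · intro j hj; rw [← Function.iterate_succ_apply]; exact h1 _ (by omega)
    · intro j hj; rw [← Function.iterate_succ_apply]; exact h2 _ (by omega)

/-! ### Polynomial primitives and parity -/

theorem natDegree_le_of_natDegree_derivative_le {P : ℝ[X]} {d : ℕ}
    (h : (Polynomial.derivative P).natDegree ≤ d) : P.natDegree ≤ d + 1 := by
  rw [Polynomial.natDegree_le_iff_coeff_eq_zero] at h ⊢
  rintro (_ | m) hm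
  · omega
  · have := h m (by omega)
    rw [Polynomial.coeff_derivative] at this
    exact (mul_eq_zero.1 this).resolve_right (by positivity)

theorem exists_derivative_eq (P : ℝ[X]) : ∃ Q : ℝ[X], Polynomial.derivative Q = P := by
  induction P using Polynomial.induction_on' with
  | add p q hp hq =>
    obtain ⟨a, rfl⟩ := hp
    obtain ⟨b, rfl⟩ := hq
    exact ⟨a + b, by simp⟩
  | monomial n a =>
    refine ⟨Polynomial.monomial (n + 1) (a / (n + 1)), ?_⟩
    rw [Polynomial.derivative_monomial]
    push_cast
    rw [div_mul_cancel₀ _ (by positivity)]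

theorem exists_iterate_derivative_eq (n : ℕ) (P : ℝ[X]) :
    ∃ Q : ℝ[X], Polynomial.derivative^[n] Q = P := by
  induction n generalizing P with
  | zero => exact ⟨P, rfl⟩
  | succ n ih =>
    obtain ⟨R, rfl⟩ := exists_derivative_eq P
    obtain ⟨Q, rfl⟩ := ih R
    exact ⟨Q, Function.iterate_succ_apply' _ _ _⟩

theorem eval_eq_of_derivative_eq_zero {P : ℝ[X]} (h : Polynomial.derivative P = 0) (x y : ℝ) :
    P.eval x = P.eval y := by
  rw [Polynomial.eq_C_of_natDegree_eq_zero (Polynomial.derivative_eq_zero.1 h)]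
  simp

theorem eval_neg_of_derivative_even {P : ℝ[X]}
    (h : ∀ x, (Polynomial.derivative P).eval (-x) = (Polynomial.derivative P).eval x)
    (h0 : P.eval 0 = 0) (x : ℝ) : P.eval (-x) = -P.eval x := by
  have h1 : Polynomial.derivative (P + P.comp (-Polynomial.X)) = 0 := by
    refine Polynomial.funext fun y => ?_
    simp [Polynomial.derivative_comp, h]
  have h2 := eval_eq_of_derivative_eq_zero h1 x 0
  simp [h0] at h2
  linarith

theorem eval_neg_of_derivative_odd {P : ℝ[X]}
    (h : ∀ x, (Polynomial.derivative P).eval (-x) = -(Polynomial.derivative P).eval x)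
    (x : ℝ) : P.eval (-x) = P.eval x := by
  have h1 : Polynomial.derivative (P - P.comp (-Polynomial.X)) = 0 := by
    refine Polynomial.funext fun y => ?_
    simp [Polynomial.derivative_comp, h]
  have h2 := eval_eq_of_derivative_eq_zero h1 x 0
  simp at h2
  linarith

theorem monotoneOn_eval {P : ℝ[X]} {a b : ℝ}
    (h : ∀ x ∈ Icc a b, 0 ≤ (Polynomial.derivative P).eval x) :
    MonotoneOn (fun x => P.eval x) (Icc a b) :=
  monotoneOn_of_deriv_nonneg (convex_Icc a b) P.continuous.continuousOn
    P.differentiable.differentiableOn fun x hx => by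
      rw [Polynomial.deriv]; exact h x (interior_subset hx)

/-- `S` is the odd primitive of the multiple of `(1 - x²)^n` which has integral `1` over
`[-1, 1]`. -/
structure IsBellPrimitive (n : ℕ) (S : ℝ[X]) : Prop where
  derivative_eq : ∃ c : ℝ, 0 < c ∧
    Polynomial.derivative S = Polynomial.C c * (1 - Polynomial.X ^ 2) ^ n
  eval_neg : ∀ x, S.eval (-x) = -S.eval x
  eval_one : S.eval 1 = 1 / 2

theorem exists_isBellPrimitive (n : ℕ) : ∃ S, IsBellPrimitive n S := by
  obtain ⟨Q, hQ⟩ := exists_derivative_eq ((1 - Polynomial.X ^ 2) ^ n)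
  set P := Q - Polynomial.C (Q.eval 0) with hP
  have hd : Polynomial.derivative P = (1 - Polynomial.X ^ 2) ^ n := by simp [hP, hQ]
  have hodd := eval_neg_of_derivative_even (P := P) (by simp [hd]) (by simp [hP])
  have hpos : 0 < P.eval 1 := by
    have : StrictMonoOn (fun x => P.eval x) (Icc 0 1) := by
      refine strictMonoOn_of_deriv_pos (convex_Icc 0 1) P.continuous.continuousOn fun x hx => ?_
      rw [interior_Icc] at hx
      rw [Polynomial.deriv, hd]
      simp only [Polynomial.eval_pow, Polynomial.eval_sub, Polynomial.eval_one, Polynomial.eval_X]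
      exact pow_pos (by nlinarith [hx.1, hx.2]) n
    have h := this (by simp : (0 : ℝ) ∈ Icc 0 1) (by simp : (1 : ℝ) ∈ Icc 0 1) one_pos
    simpa [hP] using h
  refine ⟨Polynomial.C (2 * P.eval 1)⁻¹ * P, ⟨(2 * P.eval 1)⁻¹, by positivity, ?_⟩, ?_, ?_⟩
  · rw [Polynomial.derivative_C_mul, hd]
  · intro x; simp only [Polynomial.eval_mul, Polynomial.eval_C, hodd]; ring
  · simp only [Polynomial.eval_mul, Polynomial.eval_C]; field_simp

/-! ### Endpoint zeros and bounds of bell primitives -/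

namespace IsBellPrimitive

variable {n : ℕ} {S : ℝ[X]}

theorem eval_neg_one (hS : IsBellPrimitive n S) : S.eval (-1) = -(1 / 2) := by
  rw [hS.eval_neg, hS.eval_one]

theorem natDegree_derivative_le (hS : IsBellPrimitive n S) :
    (Polynomial.derivative S).natDegree ≤ 2 * n := by
  obtain ⟨c, -, h⟩ := hS.derivative_eq
  rw [h]
  refine (Polynomial.natDegree_C_mul_le _ _).trans ?_
  refine Polynomial.natDegree_pow_le.trans ?_
  rw [mul_comm]
  refine Nat.mul_le_mul_right n ?_
  compute_degree

theorem eval_iterate_derivative (hS : IsBellPrimitive n S) {j : ℕ} (hj : j < n) {t : ℝ}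
    (ht : t ^ 2 = 1) :
    (Polynomial.derivative^[j] (Polynomial.derivative S)).eval t = 0 := by
  obtain ⟨c, -, h⟩ := hS.derivative_eq
  have h1 : (Polynomial.X - Polynomial.C t) ^ n ∣ Polynomial.derivative S := by
    rw [h]
    refine Dvd.dvd.mul_left (pow_dvd_pow_of_dvd ?_ n) _
    rw [Polynomial.dvd_iff_isRoot]
    simp [ht]
  have h2 := Polynomial.pow_sub_dvd_iterate_derivative_of_pow_dvd j h1
  rw [← Polynomial.IsRoot.def, ← Polynomial.dvd_iff_isRoot]
  exact (dvd_pow_self _ (by omega)).trans h2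

theorem derivative_nonneg (hS : IsBellPrimitive n S) {x : ℝ} (hx : x ∈ Icc (0 : ℝ) 1) :
    0 ≤ (Polynomial.derivative S).eval x := by
  obtain ⟨c, hc, h⟩ := hS.derivative_eq
  rw [h]
  simp only [Polynomial.eval_mul, Polynomial.eval_C, Polynomial.eval_pow, Polynomial.eval_sub,
    Polynomial.eval_one, Polynomial.eval_X]
  exact mul_nonneg hc.le (pow_nonneg (by nlinarith [hx.1, hx.2]) n)

theorem eval_le (hS : IsBellPrimitive n S) {x : ℝ} (hx : x ∈ Icc (0 : ℝ) 1) :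
    S.eval x ≤ 1 / 2 := by
  rw [← hS.eval_one]
  exact monotoneOn_eval (fun x hx => hS.derivative_nonneg hx) hx (by simp) hx.2

theorem eval_zero (hS : IsBellPrimitive n S) : S.eval 0 = 0 := by
  have := hS.eval_neg 0
  rw [neg_zero] at this
  linarith

/-- The bell decreases on `[0, 1]`, so `S` is concave there and lies above its chord from `(0, 0)`
to `(1, 1/2)`. -/
theorem le_eval (hS : IsBellPrimitive n S) {x : ℝ} (hx : x ∈ Icc (0 : ℝ) 1) :
    x / 2 ≤ S.eval x := by
  have hconc : ConcaveOn ℝ (Icc 0 1) fun x => S.eval x := by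
    refine AntitoneOn.concaveOn_of_deriv (convex_Icc 0 1) S.continuous.continuousOn
      S.differentiable.differentiableOn ?_
    intro y hy z hz hyz
    rw [interior_Icc] at hy hz
    obtain ⟨c, hc, h⟩ := hS.derivative_eq
    rw [Polynomial.deriv, Polynomial.deriv, h]
    simp only [Polynomial.eval_mul, Polynomial.eval_C, Polynomial.eval_pow, Polynomial.eval_sub,
      Polynomial.eval_one, Polynomial.eval_X]
    gcongr
    · nlinarith [hz.1, hz.2]
    · exact hy.1.le
  have := hconc.2 (by simp : (0 : ℝ) ∈ Icc 0 1) (by simp : (1 : ℝ) ∈ Icc 0 1)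
    (sub_nonneg.2 hx.2) hx.1 (by ring)
  simp only [smul_eq_mul, mul_zero, mul_one, zero_add, hS.eval_one, hS.eval_zero] at this
  linarith

/-- The even primitive of `S` with value `1 / 2` at `1`, which is close to `|x| / 2`. -/
theorem exists_even_primitive (hS : IsBellPrimitive n S) : ∃ a : ℝ[X],
    Polynomial.derivative a = S ∧ (∀ x, a.eval (-x) = a.eval x) ∧ a.eval 1 = 1 / 2 ∧
    ∀ x ∈ Icc (0 : ℝ) 1, a.eval x ≤ x / 2 + (1 - x) ^ 2 / 4 := by
  obtain ⟨Q, hQ⟩ := exists_derivative_eq S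
  set a := Q - Polynomial.C (Q.eval 1 - 1 / 2) with ha
  have hd : Polynomial.derivative a = S := by simp [ha, hQ]
  have h1 : a.eval 1 = 1 / 2 := by simp [ha]
  refine ⟨a, hd, eval_neg_of_derivative_odd (by rw [hd]; exact hS.eval_neg), h1, fun x hx => ?_⟩
  -- The difference of the two sides has derivative `S - x/2 ≥ 0` and vanishes at `1`.
  have m2 := monotoneOn_eval (P := a - Polynomial.C (1 / 2) * Polynomial.X -
    Polynomial.C (1 / 4) * (1 - Polynomial.X) ^ 2) (a := 0) (b := 1)
    (fun y hy => by
      have := hS.le_eval hy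
      simp [hd, Polynomial.derivative_pow] at this ⊢; linarith) hx (by simp) hx.2
  simp [h1] at m2
  linarith

end IsBellPrimitive

/-! ### Pointwise comparison of the kernels for `k = r - 2` -/

/-- With `s = S(x)` and `a = a(x)`, the two sides are `K(x)² + K(-x)²` for the kernels at `t` and at
`-1`. -/
theorem sq_add_sq_le_of_nonneg {x t s a : ℝ} (hx0 : 0 ≤ x) (hx1 : x ≤ 1) (ht0 : 0 ≤ t)
    (ht1 : t ≤ 1) (hs0 : x / 2 ≤ s) (hs1 : s ≤ 1 / 2) (ha1 : a ≤ x / 2 + (1 - x) ^ 2 / 4) :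
    (|x - t| / 2 + t * s - a) ^ 2 + (|x + t| / 2 - t * s - a) ^ 2 ≤
      ((1 + x) / 2 - s - a) ^ 2 + ((1 - x) / 2 + s - a) ^ 2 := by
  rw [abs_of_nonneg (by linarith : 0 ≤ x + t)]
  rcases le_total x t with h | h
  · rw [abs_of_nonpos (by linarith)]
    have e : ((1 + x) / 2 - s - a) ^ 2 + ((1 - x) / 2 + s - a) ^ 2 -
        ((-(x - t) / 2 + t * s - a) ^ 2 + ((x + t) / 2 - t * s - a) ^ 2) =
        (1 - t) * ((1 + t) / 2 - 2 * a + 2 * (s * ((1 + t) * s - x))) := by ring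
    have e1 : 0 ≤ (1 - t) * ((1 + t) / 2 - 2 * a + 2 * (s * ((1 + t) * s - x))) := by
      refine mul_nonneg (by linarith) ?_
      -- The left side is nondecreasing in `s` for `s ≥ x/2`. After inserting the bound on `a`, what
      -- remains is at least a multiple of `t (1 - t)²`, because `x ≤ t`.
      have e2 : s * ((1 + t) * s - x) ≥ (x / 2) * ((1 + t) * (x / 2) - x) := by
        nlinarith [mul_nonneg (sub_nonneg.2 hs0) hx0,
          mul_nonneg ht0 (mul_nonneg (sub_nonneg.2 hs0) hx0),
          mul_nonneg ht0 (sq_nonneg (s - x / 2)), sq_nonneg (s - x / 2)]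
      nlinarith [mul_nonneg ht0 (sq_nonneg (1 - t)), mul_nonneg ht0 hx0,
        mul_nonneg (sub_nonneg.2 h) hx0, mul_nonneg (sub_nonneg.2 h) ht0,
        mul_nonneg (mul_nonneg (sub_nonneg.2 h) hx0) (by linarith : 0 ≤ 2 - t),
        mul_nonneg (mul_nonneg (sub_nonneg.2 h) ht0) (by linarith : 0 ≤ 2 - t)]
    linarith
  · rw [abs_of_nonneg (by linarith)]
    have e : ((1 + x) / 2 - s - a) ^ 2 + ((1 - x) / 2 + s - a) ^ 2 -
        (((x - t) / 2 + t * s - a) ^ 2 + ((x + t) / 2 - t * s - a) ^ 2) =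
        (1 - x) * ((1 + x) / 2 - 2 * a) + 2 * (s - x / 2) ^ 2 - 2 * t ^ 2 * (1 / 2 - s) ^ 2 := by
      ring
    -- The lower bound `x (1 - x)² / 2` exactly absorbs the negative term, by `e4`.
    have e1 : (1 - x) * ((1 + x) / 2 - 2 * a) ≥ (1 - x) * (x * (1 - x) / 2) := by
      refine mul_le_mul_of_nonneg_left ?_ (by linarith)
      nlinarith
    have e2 : (1 / 2 - s) ^ 2 ≤ ((1 - x) / 2) ^ 2 := by
      refine pow_le_pow_left₀ (by linarith) (by linarith) 2
    have e3 : t ^ 2 ≤ x := by nlinarith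
    have e4 : t ^ 2 * (1 / 2 - s) ^ 2 ≤ x * ((1 - x) / 2) ^ 2 := by gcongr
    nlinarith [sq_nonneg (s - x / 2)]

theorem sq_add_sq_le {x t s a : ℝ} (hx : x ∈ Icc (0 : ℝ) 1) (ht : t ∈ I)
    (hs0 : x / 2 ≤ s) (hs1 : s ≤ 1 / 2) (ha1 : a ≤ x / 2 + (1 - x) ^ 2 / 4) :
    (|x - t| / 2 + t * s - a) ^ 2 + (|x + t| / 2 - t * s - a) ^ 2 ≤
      ((1 + x) / 2 - s - a) ^ 2 + ((1 - x) / 2 + s - a) ^ 2 := by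
  rcases le_total 0 t with h | h
  · exact sq_add_sq_le_of_nonneg hx.1 hx.2 h ht.2 hs0 hs1 ha1
  -- Replacing `t` by `-t` only swaps the two squares on the left.
  · have := sq_add_sq_le_of_nonneg hx.1 hx.2 (neg_nonneg.2 h) (by linarith [ht.1]) hs0 hs1 ha1
    rw [sub_neg_eq_add, ← sub_eq_add_neg] at this
    linarith

/-! ### Uniqueness of the solution -/

theorem natDegree_le_of_natDegree_iterate_derivative_le (n : ℕ) {P : ℝ[X]} {d : ℕ}
    (h : (Polynomial.derivative^[n] P).natDegree ≤ d) : P.natDegree ≤ d + n := by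
  induction n generalizing d with
  | zero => exact h
  | succ n ih =>
    rw [Function.iterate_succ_apply'] at h
    have := ih (natDegree_le_of_natDegree_derivative_le h)
    omega

theorem exists_eqOn_eval {m : ℕ} {f : ℝ → ℝ} (hf : ContDiffOn ℝ m f I) {Q : ℝ[X]}
    (hQ : EqOn (D m f) (fun x => Q.eval x) I) :
    ∃ P : ℝ[X], Polynomial.derivative^[m] P = Q ∧ EqOn f (fun x => P.eval x) I := by
  induction m generalizing Q with
  | zero => exact ⟨Q, rfl, by rwa [D_zero] at hQ⟩
  | succ m ih =>
    obtain ⟨R, rfl⟩ := exists_derivative_eq Q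
    have hd : DifferentiableOn ℝ (D m f) I :=
      hf.differentiableOn_iteratedDerivWithin (by exact_mod_cast Nat.lt_succ_self m) uniqueDiffOn_I
    have hc := constant_of_derivWithin_zero (f := fun x => D m f x - R.eval x) (a := -1) (b := 1)
      (hd.sub R.differentiable.differentiableOn) (fun x hx => by
        have hxI : x ∈ I := Ico_subset_Icc_self hx
        have h1 := ((hd x hxI).hasDerivWithinAt.sub (R.hasDerivAt x).hasDerivWithinAt).derivWithin
          (uniqueDiffOn_I x hxI)
        refine h1.trans ?_
        rw [← D_succ, hQ hxI, sub_self])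
    obtain ⟨P, hP, hfP⟩ := ih (Q := R + Polynomial.C (D m f (-1) - R.eval (-1)))
      (hf.of_le (by exact_mod_cast Nat.le_succ m)) (fun x hx => by
        have := hc x hx
        simp only [Polynomial.eval_add, Polynomial.eval_C]
        linarith)
    exact ⟨P, by rw [Function.iterate_succ_apply', hP]; simp, hfP⟩

/-- Absolute continuity makes `v^{(n)}` the integral of its a.e. derivative, hence constant;
integrating `n` times gives a polynomial. -/
theorem MemL2.exists_eqOn_eval_of_D_eq_zero {n : ℕ} {v : ℝ → ℝ} (hv : MemL2 (n + 1) v)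
    (h : ∀ᵐ x ∂volume.restrict (Ioo (-1 : ℝ) 1), D (n + 1) v x = 0) :
    ∃ P : ℝ[X], P.natDegree ≤ n ∧ EqOn v (fun x => P.eval x) I := by
  have hconst : EqOn (D n v) (fun x => (Polynomial.C (D n v (-1))).eval x) I := by
    intro b hb
    have h1 := integral_derivWithin_mul_eval (hv.absolutelyContinuous_D (Nat.lt_succ_self n)) 1
      (by simp : (-1 : ℝ) ∈ I) hb hb.1
    have h2 : ∫ x in (-1 : ℝ)..b, derivWithin (D n v) I x * (1 : ℝ[X]).eval x = 0 := by
      rw [← intervalIntegral.integral_zero (a := -1) (b := b)]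
      refine intervalIntegral.integral_congr_ae ?_
      have hne : ∀ᵐ x : ℝ, x ≠ 1 := by simp [ae_iff]
      filter_upwards [hne, (ae_restrict_iff' measurableSet_Ioo).1 h] with x hx hx2 hx3
      rw [uIoc_of_le hb.1] at hx3
      rw [← D_succ, hx2 ⟨hx3.1, lt_of_le_of_ne (hx3.2.trans hb.2) hx⟩, zero_mul]
    rw [h2] at h1
    simp at h1 ⊢
    linarith
  obtain ⟨P, hP, hvP⟩ := exists_eqOn_eval hv.contDiffOn hconst
  refine ⟨P, ?_, hvP⟩
  have := natDegree_le_of_natDegree_iterate_derivative_le n (P := P) (d := 0) (by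
    rw [Nat.add_sub_cancel] at hP; rw [hP]; simp)
  omega

/-- A polynomial of degree less than `2 r` is determined by its Hermite data of order `r` at
`±1`. -/
theorem eq_zero_of_hermite_data {r : ℕ} (hr : 1 ≤ r) {E : ℝ[X]} (hdeg : E.natDegree < 2 * r)
    (h1 : ∀ s < r, (Polynomial.derivative^[s] E).eval 1 = 0)
    (h2 : ∀ s < r, (Polynomial.derivative^[s] E).eval (-1) = 0) : E = 0 := by
  by_contra hE
  have key : ∀ t : ℝ, (∀ s < r, (Polynomial.derivative^[s] E).eval t = 0) →
      (Polynomial.X - Polynomial.C t) ^ r ∣ E := by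
    intro t ht
    rw [← Polynomial.le_rootMultiplicity_iff hE]
    have := (Polynomial.lt_rootMultiplicity_iff_isRoot_iterate_derivative (t := t) (n := r - 1)
      hE).2 fun m hm => ht m (by omega)
    omega
  have hcop : IsCoprime ((Polynomial.X - Polynomial.C (1 : ℝ)) ^ r)
      ((Polynomial.X - Polynomial.C (-1 : ℝ)) ^ r) :=
    (Polynomial.isCoprime_X_sub_C_of_isUnit_sub (by norm_num)).pow
  have hdvd := hcop.mul_dvd (key 1 h1) (key (-1) h2)
  have := Polynomial.natDegree_le_of_dvd hdvd hE
  rw [Polynomial.natDegree_mul (pow_ne_zero _ (Polynomial.X_sub_C_ne_zero _))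
    (pow_ne_zero _ (Polynomial.X_sub_C_ne_zero _)), Polynomial.natDegree_pow,
    Polynomial.natDegree_pow, Polynomial.natDegree_X_sub_C, Polynomial.natDegree_X_sub_C] at this
  omega

theorem isSolution_eval {r k : ℕ} (hr : 1 ≤ r) {u : ℝ[X]} (hdeg : u.natDegree ≤ 2 * r - 1)
    (hl : ∀ s < r, (Polynomial.derivative^[s] u).eval (-1) =
      if s + k + 1 = r then (-1) ^ (k + 1) else 0)
    (hrt : ∀ s < r, (Polynomial.derivative^[s] u).eval 1 = 0) :
    IsSolution r k fun x => u.eval x where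
  memL2 := memL2_eval _ _
  equation := by
    refine (ae_restrict_iff' measurableSet_Ioo).2 (Filter.Eventually.of_forall fun x hx => ?_)
    rw [D_eval _ _ (Ioo_subset_Icc_self hx), Polynomial.iterate_derivative_eq_zero (by omega)]
    simp
  left s hs := by rw [D_eval s u (by simp : (-1 : ℝ) ∈ I)]; exact hl s hs
  right s hs := by rw [D_eval s u (by simp : (1 : ℝ) ∈ I)]; exact hrt s hs

theorem IsSolution.eqOn_eval {r k : ℕ} (hr : 1 ≤ r) {u : ℝ[X]}
    (hdeg : u.natDegree ≤ 2 * r - 1) (hu : IsSolution r k fun x => u.eval x) {v : ℝ → ℝ}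
    (hv : IsSolution r k v) : EqOn v (fun x => u.eval x) I := by
  have e : 2 * r = (2 * r - 1) + 1 := by omega
  obtain ⟨P, hP, hvP⟩ := MemL2.exists_eqOn_eval_of_D_eq_zero (n := 2 * r - 1)
    (e ▸ hv.memL2) (e ▸ hv.equation)
  have hD : ∀ s, ∀ x ∈ I, (Polynomial.derivative^[s] P).eval x = D s v x := by
    intro s x hx
    rw [D, iteratedDerivWithin_congr hvP hx]
    exact (D_eval s P hx).symm
  have hz : P - u = 0 := by
    refine eq_zero_of_hermite_data hr ?_ (fun s hs => ?_) fun s hs => ?_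
    · have := Polynomial.natDegree_sub_le P u
      omega
    · have h1 : (1 : ℝ) ∈ I := by simp
      rw [Polynomial.iterate_derivative_sub, Polynomial.eval_sub, hD s 1 h1, hv.right s hs,
        ← D_eval s u h1, hu.right s hs, sub_zero]
    · have h1 : (-1 : ℝ) ∈ I := by simp
      rw [Polynomial.iterate_derivative_sub, Polynomial.eval_sub, hD s (-1) h1, hv.left s hs,
        ← D_eval s u h1, hu.left s hs, sub_self]
  rwa [sub_eq_zero.1 hz] at hvP

theorem normI_D_eval (p : ℝ≥0∞) (k : ℕ) (P : ℝ[X]) :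
    normI p (D k fun x => P.eval x) = normI p fun x => (Polynomial.derivative^[k] P).eval x :=
  normI_congr (D_eval_ae k P)

theorem normI_D_eval_eq_zero {p : ℝ≥0∞} {k : ℕ} {P : ℝ[X]} (h : P.natDegree < k) :
    normI p (D k fun x => P.eval x) = 0 := by
  rw [normI_D_eval, Polynomial.iterate_derivative_eq_zero h]
  simp [normI]

theorem memLp_of_memL2 {r : ℕ} {f : ℝ → ℝ} (hf : MemL2 r f) (hr : 1 ≤ r) :
    MemLp f 2 (volume.restrict I) := by
  have := hf.memLp_D (k := 0) (by omega) 2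
  rwa [D_zero] at this

/-! ### From kernels to the inequality and its sharpness -/

section Extremal

variable {r k : ℕ} {u : ℝ[X]} {ε : ℝ}

/-- The derivative of order `k` is represented at each point of `[-1, 1]` by kernels whose norms
are at most `‖v‖₂` and `‖u‖₂`. -/
def HasKernels (r k : ℕ) (v u : ℝ → ℝ) : Prop :=
  ∀ t ∈ I, ∃ g K : ℝ → ℝ, MemLp g 2 (volume.restrict I) ∧ MemLp K 2 (volume.restrict I) ∧
    normI 2 g ≤ normI 2 v ∧ normI 2 K ≤ normI 2 u ∧ ∀ f, MemL2 r f →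
      D k f t = (∫ x in (-1 : ℝ)..1, f x * g x) + ∫ x in (-1 : ℝ)..1, D r f x * K x

/-- The value of the derivative of order `k` at `-1` is represented by `u^{(r)}` and `ε u`. -/
def IsEndpointKernel (r k : ℕ) (ε : ℝ) (u : ℝ[X]) : Prop :=
  ∀ f, MemL2 r f → D k f (-1) =
    (∫ x in (-1 : ℝ)..1, f x * (Polynomial.derivative^[r] u).eval x) +
      ε * ∫ x in (-1 : ℝ)..1, D r f x * u.eval x

theorem additiveInequality_of_hasKernels (hk : k < r) {v u : ℝ → ℝ} (h : HasKernels r k v u) :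
    AdditiveInequality r k (normI 2 v) (normI 2 u) := by
  intro f hf
  have hf0 := memLp_of_memL2 hf (by omega)
  refine normI_top_le (add_nonneg (mul_nonneg (normI_nonneg _ _) (normI_nonneg _ _))
    (mul_nonneg (normI_nonneg _ _) (normI_nonneg _ _))) fun t ht => ?_
  obtain ⟨g, K, hg, hK, hgv, hKu, hrep⟩ := h t ht
  rw [hrep f hf]
  refine (abs_add_le _ _).trans (add_le_add ?_ ?_)
  · refine (abs_integral_mul_le hf0 hg).trans ?_
    rw [mul_comm]
    exact mul_le_mul_of_nonneg_right hgv (normI_nonneg _ _)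
  · refine (abs_integral_mul_le hf.memLp hK).trans ?_
    rw [mul_comm]
    exact mul_le_mul_of_nonneg_right hKu (normI_nonneg _ _)

namespace IsEndpointKernel

theorem eval_iterate_derivative (h : IsEndpointKernel r k ε u) (P : ℝ[X]) :
    (Polynomial.derivative^[k] P).eval (-1) =
      (∫ x in (-1 : ℝ)..1, P.eval x * (Polynomial.derivative^[r] u).eval x) +
        ε * ∫ x in (-1 : ℝ)..1, (Polynomial.derivative^[r] P).eval x * u.eval x := by
  have h1 := h _ (memL2_eval r P)
  rw [D_eval k P (by simp : (-1 : ℝ) ∈ I)] at h1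
  rw [h1]
  congr 2
  refine intervalIntegral.integral_congr fun x hx => ?_
  rw [uIcc_of_le (by norm_num)] at hx
  simp only [D_eval r P hx]

theorem eval_le_normI (P : ℝ[X]) :
    (Polynomial.derivative^[k] P).eval (-1) ≤ normI ∞ (D k fun x => P.eval x) := by
  rw [normI_D_eval]
  exact (le_abs_self _).trans
    (abs_le_normI_top (Polynomial.continuous _).continuousOn (by simp : (-1 : ℝ) ∈ I))

/-- Testing the endpoint formula on `x^k`, whose `r`-th derivative vanishes, gives `k! = ∫ x^k
u^{(r)}`. -/
theorem normI_pos (h : IsEndpointKernel r k ε u) (hk : k < r) :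
    0 < normI 2 fun x => (Polynomial.derivative^[r] u).eval x := by
  have h1 := h.eval_iterate_derivative (Polynomial.X ^ k)
  rw [Polynomial.iterate_derivative_eq_zero (x := r) (p := Polynomial.X ^ k) (by simpa using hk),
    Polynomial.iterate_derivative_X_pow_eq_C_mul] at h1
  simp [Nat.descFactorial_self] at h1
  have h2 := abs_integral_mul_le (memLp_eval (Polynomial.X ^ k) 2)
    (memLp_eval (Polynomial.derivative^[r] u) 2)
  simp only [Polynomial.eval_pow, Polynomial.eval_X] at h2
  rw [← h1] at h2
  have h3 : (0 : ℝ) < |(k.factorial : ℝ)| := by positivity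
  exact pos_of_mul_pos_right (h3.trans_le h2) (normI_nonneg _ _)

theorem natDegree_le (hdeg : u.natDegree ≤ 2 * r - 1) :
    (Polynomial.derivative^[r] u).natDegree ≤ r - 1 := by
  have := Polynomial.natDegree_iterate_derivative u r
  omega

/-- The polynomial `u^{(r)}` has degree below `r`, so the endpoint formula applied to it leaves only
`∫ (u^{(r)})²`. -/
theorem sq_le_normI (h : IsEndpointKernel r k ε u) (hk : k < r) (hdeg : u.natDegree ≤ 2 * r - 1) :
    (normI 2 fun x => (Polynomial.derivative^[r] u).eval x) ^ 2 ≤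
      normI ∞ (D k fun x => (Polynomial.derivative^[r] u).eval x) := by
  have h1 := h.eval_iterate_derivative (Polynomial.derivative^[r] u)
  have h2 := natDegree_le hdeg
  rw [Polynomial.iterate_derivative_eq_zero (x := r) (p := Polynomial.derivative^[r] u)
    (by omega)] at h1
  simp only [Polynomial.eval_zero, zero_mul, intervalIntegral.integral_zero, mul_zero, add_zero,
    ← sq] at h1
  rw [normI_two_sq (memLp_eval _ 2), ← h1]
  exact eval_le_normI _

theorem isLeast_additiveInequality (h : IsEndpointKernel r k ε u) (hk : k < r)
    (hdeg : u.natDegree ≤ 2 * r - 1)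
    (hK : HasKernels r k (fun x => (Polynomial.derivative^[r] u).eval x) fun x => u.eval x) :
    IsLeast {A : ℝ | 0 ≤ A ∧ ∃ B : ℝ, 0 ≤ B ∧ AdditiveInequality r k A B}
      (normI 2 fun x => (Polynomial.derivative^[r] u).eval x) := by
  refine ⟨⟨normI_nonneg _ _, _, normI_nonneg _ _, additiveInequality_of_hasKernels hk hK⟩, ?_⟩
  rintro A ⟨-, B, -, hAB⟩
  have h1 := hAB _ (memL2_eval r (Polynomial.derivative^[r] u))
  rw [normI_D_eval_eq_zero (p := 2) (by have := natDegree_le hdeg; omega), mul_zero,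
    add_zero] at h1
  have h2 := (h.sq_le_normI hk hdeg).trans h1
  rw [sq] at h2
  exact le_of_mul_le_mul_right h2 (h.normI_pos hk)

theorem isLeast_markovNikolskii (h : IsEndpointKernel r k ε u) (hk : k < r)
    (hdeg : u.natDegree ≤ 2 * r - 1)
    (hK : HasKernels r k (fun x => (Polynomial.derivative^[r] u).eval x) fun x => u.eval x) :
    IsLeast {M : ℝ | MarkovNikolskii (r - 1) k M}
      (normI 2 fun x => (Polynomial.derivative^[r] u).eval x) := by
  constructor
  · intro Q hQ
    have h1 := additiveInequality_of_hasKernels hk hK _ (memL2_eval r Q)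
    rwa [normI_D_eval_eq_zero (p := 2) (by omega), mul_zero, add_zero] at h1
  · intro M hM
    have h2 := (h.sq_le_normI hk hdeg).trans (hM _ (natDegree_le hdeg))
    rw [sq] at h2
    exact le_of_mul_le_mul_right h2 (h.normI_pos hk)

/-- For `P = F + l v` with `F^{(r)} = ε u / B`, the value `P^{(k)}(-1)` is `z + B` and `A ‖P‖₂ =
√(z² + c)`, where `z = p + l A²` and `c` does not depend on `l`. The difference tends to `B` as `z →
∞`. -/
theorem isLUB (h : IsEndpointKernel r k ε u) (hk : k < r) (hε : ε ^ 2 = 1)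
    (hdeg : u.natDegree ≤ 2 * r - 1)
    (hK : HasKernels r k (fun x => (Polynomial.derivative^[r] u).eval x) fun x => u.eval x) :
    IsLUB ((fun f : ℝ → ℝ => normI ∞ (D k f) -
        normI 2 (fun x => (Polynomial.derivative^[r] u).eval x) * normI 2 f) '' W r)
      (normI 2 fun x => u.eval x) := by
  have hApos := h.normI_pos hk
  set v := Polynomial.derivative^[r] u with hv
  set A := normI 2 fun x => v.eval x with hA
  set B := normI 2 fun x => u.eval x with hB
  have hB0 : 0 ≤ B := normI_nonneg _ _
  have habs : |ε| = 1 := by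
    rw [← sq_abs] at hε
    nlinarith [abs_nonneg ε]
  constructor
  · rintro _ ⟨f, ⟨hf, hf1⟩, rfl⟩
    have h1 := additiveInequality_of_hasKernels hk hK f hf
    have h2 := mul_le_mul_of_nonneg_left hf1 hB0
    simp only
    linarith
  · intro b hb
    by_contra! hlt
    -- If `B = 0` then `B⁻¹ = 0`, and the norm bound and the endpoint value below remain true.
    obtain ⟨F, hF⟩ := exists_iterate_derivative_eq r (Polynomial.C (ε * B⁻¹) * u)
    set p := ∫ x in (-1 : ℝ)..1, F.eval x * v.eval x with hp
    set q := normI 2 fun x => F.eval x with hq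
    set c := A ^ 2 * q ^ 2 - p ^ 2 with hc
    set δ := B - b with hδ
    have hδ0 : 0 < δ := sub_pos.2 hlt
    -- This makes `2 z δ = |c| + 1 > c`, contradicting `(z + δ)² ≤ z² + c`.
    set z := (|c| + 1) / (2 * δ) with hz
    have hz0 : 0 < z := by positivity
    set l := (z - p) / A ^ 2 with hl
    set P := F + Polynomial.C l * v with hP
    have hPr : Polynomial.derivative^[r] P = Polynomial.C (ε * B⁻¹) * u := by
      rw [hP, iterate_map_add, hF, Polynomial.iterate_derivative_C_mul,
        Polynomial.iterate_derivative_eq_zero (p := v)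
          ((natDegree_le hdeg).trans_lt (by omega))]
      simp
    have hPv : (fun x => P.eval x) = fun x => F.eval x + l * v.eval x := by
      ext x; simp [hP]
    have hW : (fun x => P.eval x) ∈ W r := by
      refine ⟨memL2_eval r P, ?_⟩
      rw [normI_D_eval, hPr]
      simp only [Polynomial.eval_mul, Polynomial.eval_C]
      rw [normI_two_const_mul _ (memLp_eval u 2), abs_mul, habs, one_mul,
        abs_of_nonneg (inv_nonneg.2 hB0)]
      exact inv_mul_le_one
    have hval : (Polynomial.derivative^[k] P).eval (-1) = p + l * A ^ 2 + B := by
      rw [h.eval_iterate_derivative P, hPr]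
      congr 1
      · rw [hA, normI_two_sq (memLp_eval v 2), ← intervalIntegral.integral_const_mul, hp,
          ← intervalIntegral.integral_add
            (intervalIntegrable_mul (memLp_eval F 2) (memLp_eval v 2))
            ((intervalIntegrable_sq (memLp_eval v 2)).const_mul l)]
        congr 1; ext x; simp [hP]; ring
      · have e : (fun x => (Polynomial.C (ε * B⁻¹) * u).eval x * u.eval x) =
            fun x => (ε * B⁻¹) * u.eval x ^ 2 := by
          ext x; simp; ring
        rw [e, intervalIntegral.integral_const_mul, ← normI_two_sq (memLp_eval u 2), ← hB,
          ← mul_assoc, ← mul_assoc, ← sq, hε, one_mul]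
        rcases hB0.eq_or_lt with h0 | h0
        · rw [← h0]; simp
        · field_simp
    have hle := hb (mem_image_of_mem _ hW)
    have hge := eval_le_normI (k := k) P
    set y := normI 2 fun x => P.eval x with hy
    have hsq : y ^ 2 = q ^ 2 + 2 * l * p + l ^ 2 * A ^ 2 := by
      rw [hy, hPv, normI_two_sq_add_mul (memLp_eval F 2) (memLp_eval v 2)]
    have hzl : z = p + l * A ^ 2 := by rw [hl]; field_simp; ring
    have h3 : z + δ ≤ A * y := by
      linarith
    have h4 : (z + δ) ^ 2 ≤ (A * y) ^ 2 := pow_le_pow_left₀ (by linarith) h3 2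
    have h5 : (A * y) ^ 2 = z ^ 2 + c := by rw [mul_pow, hsq, hzl, hc]; ring
    have h6 : 2 * z * δ = |c| + 1 := by rw [hz]; field_simp
    nlinarith [le_abs_self c, sq_nonneg δ]

end IsEndpointKernel

end Extremal

/-! ### Integral representations with a kernel broken at `t` -/

/-- The function equal to `P` on the left of `t` and to `Q` on the right of `t`. -/
noncomputable def glue (P Q : ℝ[X]) (t x : ℝ) : ℝ := if x ≤ t then P.eval x else Q.eval x

theorem memLp_glue (P Q : ℝ[X]) (t : ℝ) : MemLp (glue P Q t) 2 (volume.restrict I) := by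
  have e : glue P Q t = (Iic t).piecewise (fun x => P.eval x) fun x => Q.eval x := by
    ext x; simp [glue, Set.piecewise]
  rw [e]
  exact MemLp.piecewise measurableSet_Iic ((memLp_eval P 2).restrict _)
    ((memLp_eval Q 2).restrict _)

theorem intervalIntegrable_of_continuousOn {f : ℝ → ℝ} (hf : ContinuousOn f I) {a b : ℝ}
    (ha : a ∈ I) (hb : b ∈ I) : IntervalIntegrable f volume a b :=
  (hf.mono (ordConnected_Icc.uIcc_subset ha hb)).intervalIntegrable

theorem integral_mul_glue {g : ℝ → ℝ} (hg : MemLp g 2 (volume.restrict I)) (P Q : ℝ[X]) {t : ℝ}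
    (ht : t ∈ I) : ∫ x in (-1 : ℝ)..1, g x * glue P Q t x =
      (∫ x in (-1 : ℝ)..t, g x * P.eval x) + ∫ x in t..1, g x * Q.eval x := by
  have hi := intervalIntegrable_mul hg (memLp_glue P Q t)
  have h1 : IntervalIntegrable (fun x => g x * glue P Q t x) volume (-1) t := hi.mono_set (by
    rw [uIcc_of_le ht.1, uIcc_of_le (by norm_num)]; exact Icc_subset_Icc_right ht.2)
  have h2 : IntervalIntegrable (fun x => g x * glue P Q t x) volume t 1 := hi.mono_set (by
    rw [uIcc_of_le ht.2, uIcc_of_le (by norm_num)]; exact Icc_subset_Icc_left ht.1)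
  rw [← intervalIntegral.integral_add_adjacent_intervals h1 h2]
  congr 1
  · refine intervalIntegral.integral_congr fun x hx => ?_
    rw [uIcc_of_le ht.1] at hx
    simp [glue, hx.2]
  · refine intervalIntegral.integral_congr_ae (Filter.Eventually.of_forall fun x hx => ?_)
    rw [uIoc_of_le ht.2] at hx
    simp [glue, hx.1]

/-- The kernel `S ± 1/2` vanishes at both endpoints and drops by `1` at `t`, so integration by parts
on the two sides leaves only `G t` and `-∫ G S'`. -/
theorem eq_integral_add_of_primitive {G : ℝ → ℝ} (hG : AbsolutelyContinuousOnInterval G (-1) 1)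
    {S : ℝ[X]} (h1 : S.eval 1 = 1 / 2) (h2 : S.eval (-1) = -(1 / 2)) {t : ℝ} (ht : t ∈ I) :
    G t = (∫ x in (-1 : ℝ)..1, G x * (Polynomial.derivative S).eval x) +
      ((∫ x in (-1 : ℝ)..t, derivWithin G I x * (S + Polynomial.C (1 / 2)).eval x) +
        ∫ x in t..1, derivWithin G I x * (S - Polynomial.C (1 / 2)).eval x) := by
  have hm : (-1 : ℝ) ∈ I := by simp
  have hp : (1 : ℝ) ∈ I := by simp
  have hc : ContinuousOn (fun x => G x * (Polynomial.derivative S).eval x) I := by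
    have := hG.continuousOn
    rw [uIcc_of_le (by norm_num)] at this
    exact this.mul (Polynomial.continuous _).continuousOn
  rw [integral_derivWithin_mul_eval hG _ hm ht ht.1, integral_derivWithin_mul_eval hG _ ht hp ht.2]
  simp only [Polynomial.derivative_add, Polynomial.derivative_sub, Polynomial.derivative_C,
    add_zero, sub_zero]
  rw [← intervalIntegral.integral_add_adjacent_intervals
    (intervalIntegrable_of_continuousOn hc hm ht) (intervalIntegrable_of_continuousOn hc ht hp)]
  simp [h1, h2]
  ring

/-- The kernel against `f^{(m+2)}` is `|x - t|/2 + t S - a`. It is continuous at `t`, vanishes at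
`±1`, and has derivative `t S' - (T ± 1/2)`; one integration by parts reduces the formula to
`eq_integral_add_of_primitive` for `T`. -/
theorem MemL2.D_eq_integral_add {m : ℕ} {f : ℝ → ℝ} (hf : MemL2 (m + 2) f) {S T a : ℝ[X]}
    (hS1 : S.eval 1 = 1 / 2) (hS2 : S.eval (-1) = -(1 / 2)) (hT1 : T.eval 1 = 1 / 2)
    (hT2 : T.eval (-1) = -(1 / 2)) (ha : Polynomial.derivative a = T) (ha1 : a.eval 1 = 1 / 2)
    (ha2 : a.eval (-1) = 1 / 2) {t : ℝ} (ht : t ∈ I) :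
    D m f t = (∫ x in (-1 : ℝ)..1, D m f x * (Polynomial.derivative T).eval x) +
      t * (∫ x in (-1 : ℝ)..1, D (m + 1) f x * (Polynomial.derivative S).eval x) +
      ((∫ x in (-1 : ℝ)..t, D (m + 2) f x * (Polynomial.C (1 / 2) *
          (Polynomial.C t - Polynomial.X) + Polynomial.C t * S - a).eval x) +
        ∫ x in t..1, D (m + 2) f x * (Polynomial.C (1 / 2) *
          (Polynomial.X - Polynomial.C t) + Polynomial.C t * S - a).eval x) := by
  have hm : (-1 : ℝ) ∈ I := by simp
  have hp : (1 : ℝ) ∈ I := by simp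
  have hcont : ∀ Q : ℝ[X], ContinuousOn (fun x => D (m + 1) f x * Q.eval x) I := fun Q =>
    (hf.continuousOn_D (by omega)).mul (Polynomial.continuous _).continuousOn
  have hint : ∀ (Q : ℝ[X]) {b c : ℝ}, b ∈ I → c ∈ I →
      IntervalIntegrable (fun x => D (m + 1) f x * Q.eval x) volume b c := fun Q _ _ hb hc =>
    intervalIntegrable_of_continuousOn (hcont Q) hb hc
  have hsplit : ∀ (R Q : ℝ[X]) {b c : ℝ}, b ∈ I → c ∈ I → R = Polynomial.C t *
      Polynomial.derivative S - Q → ∫ x in b..c, D (m + 1) f x * R.eval x =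
      t * (∫ x in b..c, D (m + 1) f x * (Polynomial.derivative S).eval x) -
        ∫ x in b..c, D (m + 1) f x * Q.eval x := by
    rintro R Q b c hb hc rfl
    rw [← intervalIntegral.integral_const_mul, ← intervalIntegral.integral_sub
      ((hint _ hb hc).const_mul t) (hint _ hb hc)]
    congr 1; ext x; simp; ring
  have hG := hf.absolutelyContinuous_D (k := m + 1) (by omega)
  have hF := eq_integral_add_of_primitive (hf.absolutelyContinuous_D (k := m) (by omega)) hT1 hT2 ht
  rw [← D_succ] at hF
  rw [D_succ (m + 1), integral_derivWithin_mul_eval hG _ hm ht ht.1,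
    integral_derivWithin_mul_eval hG _ ht hp ht.2,
    hsplit _ (T + Polynomial.C (1 / 2)) hm ht (by
      simp only [Polynomial.derivative_sub, Polynomial.derivative_add, Polynomial.derivative_mul,
        Polynomial.derivative_C, Polynomial.derivative_X, ha]
      ring),
    hsplit _ (T - Polynomial.C (1 / 2)) ht hp (by
      simp only [Polynomial.derivative_sub, Polynomial.derivative_add, Polynomial.derivative_mul,
        Polynomial.derivative_C, Polynomial.derivative_X, ha]
      ring),
    ← intervalIntegral.integral_add_adjacent_intervals
      (hint (Polynomial.derivative S) hm ht) (hint (Polynomial.derivative S) ht hp)]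
  have e1 : (Polynomial.C (1 / 2) * (Polynomial.C t - Polynomial.X) +
      Polynomial.C t * S - a).eval (-1) = 0 := by
    simp [hS2, ha2]; ring
  have e2 : (Polynomial.C (1 / 2) * (Polynomial.X - Polynomial.C t) +
      Polynomial.C t * S - a).eval 1 = 0 := by
    simp [hS1, ha1]; ring
  have e3 : (Polynomial.C (1 / 2) * (Polynomial.C t - Polynomial.X) +
      Polynomial.C t * S - a).eval t = (Polynomial.C (1 / 2) * (Polynomial.X - Polynomial.C t) +
      Polynomial.C t * S - a).eval t := by simp
  rw [e1, e2, e3]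
  linear_combination hF

theorem MemL2.integral_D_mul_derivative {r n : ℕ} {f : ℝ → ℝ} (hf : MemL2 r f) (hn : n ≤ r)
    {S : ℝ[X]} (hS : IsBellPrimitive n S) :
    ∫ x in (-1 : ℝ)..1, D n f x * (Polynomial.derivative S).eval x =
      ∫ x in (-1 : ℝ)..1, f x *
        (Polynomial.C ((-1) ^ n) * Polynomial.derivative^[n + 1] S).eval x := by
  rw [hf.integral_D_mul_eval hn _ (fun j hj => hS.eval_iterate_derivative hj (by norm_num))
    (fun j hj => hS.eval_iterate_derivative hj (by norm_num)),
    ← intervalIntegral.integral_const_mul, Function.iterate_succ_apply]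
  congr 1; ext x; simp; ring

/-! ### The case `k = r - 1` -/

section TopDerivative

variable {n : ℕ} {S : ℝ[X]}

theorem iterate_derivative_solution_top (n : ℕ) (S : ℝ[X]) :
    Polynomial.derivative^[n + 1] (Polynomial.C ((-1) ^ n) * (S - Polynomial.C (1 / 2))) =
      Polynomial.C ((-1) ^ n) * Polynomial.derivative^[n + 1] S := by
  rw [Polynomial.iterate_derivative_C_mul, Polynomial.iterate_derivative_sub,
    Polynomial.iterate_derivative_C (by omega), sub_zero]

theorem isEndpointKernel_top (hS : IsBellPrimitive n S) :
    IsEndpointKernel (n + 1) n ((-1) ^ n)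
      (Polynomial.C ((-1) ^ n) * (S - Polynomial.C (1 / 2))) := by
  intro f hf
  rw [eq_integral_add_of_primitive (hf.absolutelyContinuous_D (by omega)) hS.eval_one
    hS.eval_neg_one (by simp : (-1 : ℝ) ∈ I), hf.integral_D_mul_derivative (by omega) hS,
    iterate_derivative_solution_top, intervalIntegral.integral_same, zero_add, ← D_succ,
    ← intervalIntegral.integral_const_mul]
  congr 2
  ext x
  rw [Polynomial.eval_mul, Polynomial.eval_C]
  have : ((-1 : ℝ) ^ n) * (-1) ^ n = 1 := by rw [← mul_pow]; norm_num
  linear_combination (-(D (n + 1) f x * (S - Polynomial.C (1 / 2)).eval x)) * this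

theorem hasKernels_top (hS : IsBellPrimitive n S) :
    HasKernels (n + 1) n
      (fun x => (Polynomial.derivative^[n + 1]
        (Polynomial.C ((-1) ^ n) * (S - Polynomial.C (1 / 2)))).eval x)
      (fun x => (Polynomial.C ((-1) ^ n) * (S - Polynomial.C (1 / 2))).eval x) := by
  intro t ht
  refine ⟨_, glue (S + Polynomial.C (1 / 2)) (S - Polynomial.C (1 / 2)) t, memLp_eval _ 2,
    memLp_glue _ _ _, le_rfl, ?_, fun f hf => ?_⟩
  · refine normI_two_le_of_symm (memLp_glue _ _ _) (memLp_eval _ 2) fun x hx => ?_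
    have hs := hS.le_eval hx
    have hs0 : 0 ≤ S.eval x := by linarith [hx.1]
    have h1 : ((-1 : ℝ) ^ n) ^ 2 = 1 := by rw [← pow_mul, mul_comm, pow_mul]; norm_num
    simp only [glue, Polynomial.eval_mul, Polynomial.eval_C, Polynomial.eval_sub,
      Polynomial.eval_add, hS.eval_neg, mul_pow, h1, one_mul]
    rcases le_or_gt x t with h | h
    · rw [if_pos h, if_pos (by linarith [hx.1])]
      exact le_of_eq (by ring)
    · rw [if_neg h.not_ge]
      -- If `x` and `-x` lie on the same side of `t` there is equality; otherwise the claim is `2 (S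
      -- - 1/2)² ≤ (S - 1/2)² + (S + 1/2)²`, true since `S ≥ 0`.
      split_ifs <;> nlinarith
  · rw [integral_mul_glue hf.memLp _ _ ht, iterate_derivative_solution_top,
      ← hf.integral_D_mul_derivative (by omega) hS, D_succ]
    exact eq_integral_add_of_primitive (hf.absolutelyContinuous_D (by omega)) hS.eval_one
      hS.eval_neg_one ht

theorem natDegree_solution_top_le (hS : IsBellPrimitive n S) :
    (Polynomial.C ((-1) ^ n) * (S - Polynomial.C (1 / 2))).natDegree ≤ 2 * (n + 1) - 1 := by
  refine (Polynomial.natDegree_C_mul_le _ _).trans ?_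
  rw [Polynomial.natDegree_sub_C]
  have := natDegree_le_of_natDegree_derivative_le hS.natDegree_derivative_le
  omega

theorem isSolution_top (hS : IsBellPrimitive n S) : IsSolution (n + 1) n fun x =>
    (Polynomial.C ((-1) ^ n) * (S - Polynomial.C (1 / 2))).eval x := by
  refine isSolution_eval (by omega) (natDegree_solution_top_le hS) ?_ ?_
  · rintro (_ | s) hs
    · simp [hS.eval_neg_one]; ring
    · rw [Polynomial.iterate_derivative_C_mul, Polynomial.iterate_derivative_sub,
        Polynomial.iterate_derivative_C (by omega), sub_zero, Function.iterate_succ_apply,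
        Polynomial.eval_mul, hS.eval_iterate_derivative (by omega) (by norm_num), mul_zero,
        if_neg (by omega)]
  · rintro (_ | s) hs
    · simp [hS.eval_one]
    · rw [Polynomial.iterate_derivative_C_mul, Polynomial.iterate_derivative_sub,
        Polynomial.iterate_derivative_C (by omega), sub_zero, Function.iterate_succ_apply,
        Polynomial.eval_mul, hS.eval_iterate_derivative (by omega) (by norm_num), mul_zero]

end TopDerivative

/-! ### The case `k = r - 2` -/

section PenultimateDerivative

variable {m : ℕ} {S T a : ℝ[X]}

/-- The solution of the boundary value problem with `r = m + 2` and `k = m`. -/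
noncomputable def penultimateSolution (m : ℕ) (S a : ℝ[X]) : ℝ[X] :=
  Polynomial.C ((-1) ^ (m + 1)) *
    (Polynomial.C (1 / 2) * (Polynomial.X - Polynomial.C (-1)) + Polynomial.C (-1) * S - a)

theorem iterate_derivative_penultimateSolution (ha : Polynomial.derivative a = T)
    (j : ℕ) (hj : 2 ≤ j) : Polynomial.derivative^[j] (penultimateSolution m S a) =
      Polynomial.C ((-1) ^ m) * (Polynomial.derivative^[j - 1] T) -
        Polynomial.C ((-1) ^ (m + 1)) * Polynomial.derivative^[j] S := by
  obtain ⟨i, rfl⟩ : ∃ i, j = i + 1 := ⟨j - 1, by omega⟩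
  rw [penultimateSolution, Polynomial.iterate_derivative_C_mul, Polynomial.iterate_derivative_sub,
    iterate_map_add, Polynomial.iterate_derivative_C_mul, Polynomial.iterate_derivative_C_mul,
    Polynomial.iterate_derivative_eq_zero (p := Polynomial.X - Polynomial.C (-1))
      (by rw [Polynomial.natDegree_X_sub_C]; omega),
    Function.iterate_succ_apply _ i a, ha, Nat.add_sub_cancel, pow_succ]
  simp
  ring

/-- The second factor is, up to sign, the derivative of order `m + 1` of a bell vanishing to that
order at `±1`, so it is orthogonal to polynomials of degree at most `m`, such as the first factor.
-/
theorem integral_iterate_derivative_mul_eq_zero (hT : IsBellPrimitive m T)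
    (hS : IsBellPrimitive (m + 1) S) :
    ∫ x in (-1 : ℝ)..1, (Polynomial.C ((-1) ^ m) * Polynomial.derivative^[m + 1] T).eval x *
      (Polynomial.C ((-1) ^ (m + 1)) * Polynomial.derivative^[m + 1 + 1] S).eval x = 0 := by
  rw [← (memL2_eval (m + 1) _).integral_D_mul_derivative le_rfl hS]
  rw [intervalIntegral.integral_congr (g := fun _ => 0), intervalIntegral.integral_zero]
  intro x hx
  rw [uIcc_of_le (by norm_num)] at hx
  have hdeg := natDegree_le_of_natDegree_derivative_le hT.natDegree_derivative_le
  simp only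
  rw [D_eval _ _ hx, Polynomial.iterate_derivative_C_mul, ← Function.iterate_add_apply,
    Polynomial.iterate_derivative_eq_zero (by omega)]
  simp

/-- At `t = -1` the left piece of the kernel disappears and the right piece is `±` the solution,
while `g_{-1} = α - β` is its derivative of order `m + 2`. -/
theorem isEndpointKernel_penultimate (hT : IsBellPrimitive m T)
    (hS : IsBellPrimitive (m + 1) S) (ha : Polynomial.derivative a = T) (ha1 : a.eval 1 = 1 / 2)
    (ha2 : a.eval (-1) = 1 / 2) :
    IsEndpointKernel (m + 2) m ((-1) ^ (m + 1)) (penultimateSolution m S a) := by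
  intro f hf
  have hf2 := memLp_of_memL2 hf (by omega)
  rw [hf.D_eq_integral_add hS.eval_one hS.eval_neg_one hT.eval_one hT.eval_neg_one ha ha1 ha2
    (by simp : (-1 : ℝ) ∈ I), hf.integral_D_mul_derivative (by omega) hS,
    hf.integral_D_mul_derivative (by omega) hT,
    iterate_derivative_penultimateSolution ha _ (by omega), intervalIntegral.integral_same,
    zero_add, ← intervalIntegral.integral_const_mul, ← intervalIntegral.integral_const_mul,
    ← intervalIntegral.integral_add (intervalIntegrable_mul hf2 (memLp_eval _ 2))
      ((intervalIntegrable_mul hf2 (memLp_eval _ 2)).const_mul _)]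
  congr 2
  · ext x
    rw [Polynomial.eval_sub, show m + 2 - 1 = m + 1 by omega]
    ring
  · ext x
    rw [penultimateSolution, Polynomial.eval_mul, Polynomial.eval_C]
    have : ((-1 : ℝ) ^ (m + 1)) * (-1) ^ (m + 1) = 1 := by rw [← mul_pow]; norm_num
    linear_combination (-(D (m + 2) f x * (Polynomial.C (1 / 2) *
      (Polynomial.X - Polynomial.C (-1)) + Polynomial.C (-1) * S - a).eval x)) * this

theorem hasKernels_penultimate (hT : IsBellPrimitive m T)
    (hS : IsBellPrimitive (m + 1) S) (ha : Polynomial.derivative a = T) (ha1 : a.eval 1 = 1 / 2)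
    (haneg : ∀ x, a.eval (-x) = a.eval x)
    (hale : ∀ x ∈ Icc (0 : ℝ) 1, a.eval x ≤ x / 2 + (1 - x) ^ 2 / 4) :
    HasKernels (m + 2) m
      (fun x => (Polynomial.derivative^[m + 2] (penultimateSolution m S a)).eval x)
      (fun x => (penultimateSolution m S a).eval x) := by
  intro t ht
  set α := Polynomial.C ((-1) ^ m) * Polynomial.derivative^[m + 1] T with hα
  set β := Polynomial.C ((-1) ^ (m + 1)) * Polynomial.derivative^[m + 1 + 1] S with hβ
  have hαβ := integral_iterate_derivative_mul_eq_zero hT hS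
  rw [← hα, ← hβ] at hαβ
  refine ⟨fun x => α.eval x + t * β.eval x,
    glue (Polynomial.C (1 / 2) * (Polynomial.C t - Polynomial.X) + Polynomial.C t * S - a)
      (Polynomial.C (1 / 2) * (Polynomial.X - Polynomial.C t) + Polynomial.C t * S - a) t,
    (memLp_eval _ 2).add ((memLp_eval _ 2).const_mul t), memLp_glue _ _ _, ?_, ?_,
    fun f hf => ?_⟩
  · have e : (fun x => (Polynomial.derivative^[m + 2] (penultimateSolution m S a)).eval x) =
        fun x => α.eval x + (-1) * β.eval x := by
      ext x
      rw [iterate_derivative_penultimateSolution ha _ (by omega), Polynomial.eval_sub,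
        show m + 2 - 1 = m + 1 by omega, hα, hβ]
      ring
    -- By orthogonality the squared norm is `‖α‖² + t² ‖β‖²`, and `t² ≤ 1`.
    refine (pow_le_pow_iff_left₀ (normI_nonneg _ _) (normI_nonneg _ _) two_ne_zero).1 ?_
    rw [e, normI_two_sq_add_mul (memLp_eval α 2) (memLp_eval β 2),
      normI_two_sq_add_mul (memLp_eval α 2) (memLp_eval β 2), hαβ]
    have ht2 : t ^ 2 ≤ 1 := by nlinarith [ht.1, ht.2]
    nlinarith [mul_le_mul_of_nonneg_right ht2 (sq_nonneg (normI 2 fun x => β.eval x))]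
  · refine normI_two_le_of_symm (memLp_glue _ _ _) (memLp_eval _ 2) fun x hx => ?_
    have h1 : ((-1 : ℝ) ^ (m + 1)) ^ 2 = 1 := by rw [← pow_mul, mul_comm, pow_mul]; norm_num
    have hglue : ∀ y, glue
        (Polynomial.C (1 / 2) * (Polynomial.C t - Polynomial.X) + Polynomial.C t * S - a)
        (Polynomial.C (1 / 2) * (Polynomial.X - Polynomial.C t) + Polynomial.C t * S - a) t y =
        |y - t| / 2 + t * S.eval y - a.eval y := by
      intro y
      simp only [glue, Polynomial.eval_mul, Polynomial.eval_C, Polynomial.eval_sub,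
        Polynomial.eval_add, Polynomial.eval_X]
      split_ifs with h
      · rw [abs_of_nonpos (by linarith)]; ring
      · rw [abs_of_nonneg (by linarith)]; ring
    have key := sq_add_sq_le hx ht (hS.le_eval hx) (hS.eval_le hx) (hale x hx)
    rw [hglue, hglue, hS.eval_neg, haneg, abs_sub_comm (-x), sub_neg_eq_add, add_comm t x]
    simp only [penultimateSolution, Polynomial.eval_mul, Polynomial.eval_C, Polynomial.eval_sub,
      Polynomial.eval_add, Polynomial.eval_X, hS.eval_neg, haneg, mul_pow, h1, one_mul]
    calc _ = (|x - t| / 2 + t * S.eval x - a.eval x) ^ 2 +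
          (|x + t| / 2 - t * S.eval x - a.eval x) ^ 2 := by ring
      _ ≤ _ := key
      _ = _ := by ring
  · have hf2 := memLp_of_memL2 hf (by omega)
    rw [integral_mul_glue hf.memLp _ _ ht, hf.D_eq_integral_add hS.eval_one hS.eval_neg_one
      hT.eval_one hT.eval_neg_one ha ha1 (by rw [haneg, ha1]) ht,
      hf.integral_D_mul_derivative (by omega) hS, hf.integral_D_mul_derivative (by omega) hT,
      ← hα, ← hβ, ← intervalIntegral.integral_const_mul,
      ← intervalIntegral.integral_add (intervalIntegrable_mul hf2 (memLp_eval _ 2))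
      ((intervalIntegrable_mul hf2 (memLp_eval _ 2)).const_mul _)]
    congr 2
    ext x
    ring

theorem natDegree_penultimateSolution_le (hT : IsBellPrimitive m T)
    (hS : IsBellPrimitive (m + 1) S) (ha : Polynomial.derivative a = T) :
    (penultimateSolution m S a).natDegree ≤ 2 * (m + 2) - 1 := by
  have hS' := natDegree_le_of_natDegree_derivative_le hS.natDegree_derivative_le
  have ha' := natDegree_le_of_natDegree_derivative_le
    (ha ▸ natDegree_le_of_natDegree_derivative_le hT.natDegree_derivative_le)
  rw [penultimateSolution]
  refine (Polynomial.natDegree_C_mul_le _ _).trans ?_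
  refine (Polynomial.natDegree_sub_le _ _).trans (max_le ?_ (by omega))
  refine (Polynomial.natDegree_add_le _ _).trans (max_le ?_ ?_)
  · refine (Polynomial.natDegree_C_mul_le _ _).trans ?_
    rw [Polynomial.natDegree_X_sub_C]; omega
  · exact (Polynomial.natDegree_C_mul_le _ _).trans (by omega)

theorem isSolution_penultimate (hT : IsBellPrimitive m T)
    (hS : IsBellPrimitive (m + 1) S) (ha : Polynomial.derivative a = T) (ha1 : a.eval 1 = 1 / 2)
    (ha2 : a.eval (-1) = 1 / 2) :
    IsSolution (m + 2) m fun x => (penultimateSolution m S a).eval x := by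
  have hhigh : ∀ (s : ℕ) (t : ℝ), s + 2 < m + 2 → t ^ 2 = 1 →
      (Polynomial.derivative^[s + 2] (penultimateSolution m S a)).eval t = 0 := by
    intro s t hs ht
    rw [iterate_derivative_penultimateSolution ha _ (by omega), show s + 2 - 1 = s + 1 by omega,
      Function.iterate_succ_apply, Function.iterate_succ_apply _ (s + 1), Polynomial.eval_sub,
      Polynomial.eval_mul, Polynomial.eval_mul, hT.eval_iterate_derivative (by omega) ht,
      hS.eval_iterate_derivative (by omega) ht]
    ring
  have hS0 : ∀ t : ℝ, t ^ 2 = 1 → (Polynomial.derivative S).eval t = 0 := fun t ht =>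
    hS.eval_iterate_derivative (j := 0) (by omega) ht
  have hd : Polynomial.derivative (penultimateSolution m S a) = Polynomial.C ((-1) ^ (m + 1)) *
      (Polynomial.C (1 / 2) - Polynomial.derivative S - T) := by
    rw [penultimateSolution, Polynomial.derivative_C_mul]
    simp [ha, sub_eq_add_neg]
  refine isSolution_eval (by omega) (natDegree_penultimateSolution_le hT hS ha) ?_ ?_
  · rintro (_ | _ | s) hs
    · rw [if_neg (by omega)]
      simp [penultimateSolution, hS.eval_neg_one, ha2]
    · rw [if_pos (by omega)]
      simp only [zero_add, Function.iterate_one, hd]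
      simp [hT.eval_neg_one, hS0]
      norm_num
    · rw [hhigh s _ hs (by norm_num), if_neg (by omega)]
  · rintro (_ | _ | s) hs
    · simp [penultimateSolution, hS.eval_one, ha1]; norm_num
    · simp only [zero_add, Function.iterate_one, hd]
      simp [hT.eval_one, hS0]
    · exact hhigh s _ hs (by norm_num)

end PenultimateDerivative

/-! ### Assembly -/

theorem exists_solution_with_kernels {r k : ℕ} (hr : 3 ≤ r) (hk : k = r - 2 ∨ k = r - 1) :
    ∃ (u : ℝ[X]) (ε : ℝ), u.natDegree ≤ 2 * r - 1 ∧ ε ^ 2 = 1 ∧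
      (IsSolution r k fun x => u.eval x) ∧ IsEndpointKernel r k ε u ∧
      HasKernels r k (fun x => (Polynomial.derivative^[r] u).eval x) fun x => u.eval x := by
  have hε : ∀ n : ℕ, ((-1 : ℝ) ^ n) ^ 2 = 1 := fun n => by
    rw [← pow_mul, mul_comm, pow_mul]; norm_num
  rcases hk with rfl | rfl
  · obtain ⟨m, rfl⟩ : ∃ m, r = m + 2 := ⟨r - 2, by omega⟩
    obtain ⟨S, hS⟩ := exists_isBellPrimitive (m + 1)
    obtain ⟨T, hT⟩ := exists_isBellPrimitive m
    obtain ⟨a, ha, haneg, ha1, hale⟩ := hT.exists_even_primitive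
    have ha2 : a.eval (-1) = 1 / 2 := by rw [haneg, ha1]
    exact ⟨penultimateSolution m S a, (-1) ^ (m + 1), natDegree_penultimateSolution_le hT hS ha,
      hε _, isSolution_penultimate hT hS ha ha1 ha2,
      isEndpointKernel_penultimate hT hS ha ha1 ha2,
      hasKernels_penultimate hT hS ha ha1 haneg hale⟩
  · obtain ⟨n, rfl⟩ : ∃ n, r = n + 1 := ⟨r - 1, by omega⟩
    obtain ⟨S, hS⟩ := exists_isBellPrimitive n
    exact ⟨_, (-1) ^ n, natDegree_solution_top_le hS, hε _, isSolution_top hS,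
      isEndpointKernel_top hS, hasKernels_top hS⟩

end TaikovInterval

theorem mainTheorem12 (r k : ℕ) (hr : 3 ≤ r) (hk : k = r - 2 ∨ k = r - 1) :
    ∃ u₀ : ℝ[X],
      -- `u₀` is the unique solution of the boundary value problem, a polynomial
      u₀.natDegree ≤ 2 * r - 1 ∧
      TaikovInterval.IsSolution r k (fun x => u₀.eval x) ∧
      (∀ v : ℝ → ℝ, TaikovInterval.IsSolution r k v →
        EqOn v (fun x => u₀.eval x) TaikovInterval.I) ∧
      -- the inequality with `A = ‖u₀^{(r)}‖₂` and `B = ‖u₀‖₂`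
      TaikovInterval.AdditiveInequality r k
        (TaikovInterval.normI 2 (TaikovInterval.D r fun x => u₀.eval x))
        (TaikovInterval.normI 2 fun x => u₀.eval x) ∧
      -- sharpness: `B = sup {‖f^{(k)}‖_∞ - A ‖f‖₂ : f ∈ W_2^r}`
      IsLUB ((fun f : ℝ → ℝ => TaikovInterval.normI ∞ (TaikovInterval.D k f) -
          TaikovInterval.normI 2 (TaikovInterval.D r fun x => u₀.eval x) *
            TaikovInterval.normI 2 f) '' TaikovInterval.W r)
        (TaikovInterval.normI 2 fun x => u₀.eval x) ∧
      -- `A` is the least constant for which the inequality holds with some `B`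
      IsLeast {A : ℝ | 0 ≤ A ∧ ∃ B : ℝ, 0 ≤ B ∧ TaikovInterval.AdditiveInequality r k A B}
        (TaikovInterval.normI 2 (TaikovInterval.D r fun x => u₀.eval x)) ∧
      -- `A` is the sharp constant in the Markov-Nikolskii inequality
      IsLeast {M : ℝ | TaikovInterval.MarkovNikolskii (r - 1) k M}
        (TaikovInterval.normI 2 (TaikovInterval.D r fun x => u₀.eval x)) := by
  obtain ⟨u, ε, hdeg, hε, hu, hend, hK⟩ := TaikovInterval.exists_solution_with_kernels hr hk
  have hkr : k < r := by omega
  refine ⟨u, hdeg, hu, fun v hv => hu.eqOn_eval (by omega) hdeg hv, ?_⟩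
  rw [TaikovInterval.normI_D_eval]
  exact ⟨TaikovInterval.additiveInequality_of_hasKernels hkr hK, hend.isLUB hkr hε hdeg hK,
    hend.isLeast_additiveInequality hkr hdeg hK, hend.isLeast_markovNikolskii hkr hdeg hK⟩
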